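/- Identify a bipartite graph on $L\sqcup R$, $L=\{\ell_1,\dots,\ell_n\}$, $R=\{r_1,\dots,r_d\}$, with its set of edges, and let $P(G)=\operatorname{conv}\{(e_j,e_i) : (\ell_j,r_i)\in G\}\subseteq\Delta_{n-1}\times\Delta_{d-1}$. A triangulation of $\Delta_{n-1}\times\Delta_{d-1}$ is a geometric simplicial complex covering it, all of whose vertices are vertices $(e_j,e_i)$. Let $v\in\mathbb Z_{>0}^d$ with $k=\sum_i v_i\le n$. A tope of type $v$ on a $k$-subset $\sigma\subseteq L$ is a bipartite graph with right degree vector $v$ and left degree vector $\mathbf 1_\sigma$. An $(n,d)$-tope field of type $v$ and thickness $k$ is a family $(M_\sigma)$ with one tope $M_\sigma$ of type $v$ on each $k$-subset $\sigma$; it is a matching field if $v=(1,\dots,1)$. For $|\tau|=k+1$ put $C_\tau=\bigcup_{\sigma\subset\tau}M_\sigma$. The $i$-amalgamation of $M$ is the tope field $(G_\tau)$ of type $v+e_i$, where $G_\tau$ is the unique tope of type $v+e_i$ on $\tau$ contained in $C_\tau$. The maximal topes of a matching field are the single topes of the tope fields of thickness $n$ obtained from it by iterated amalgamation. A matching field $M$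 is linkage if for every $r_i\in R$ and every $(d+1)$-subset $\tau\subseteq L$ there are distinct $\ell_j,\ell_{j'}\in\tau$ such that $M_{\tau\setminus\{\ell_j\}}$ and $M_{\tau\setminus\{\ell_{j'}\}}$ agree everywhere other than on $r_i$. It is polyhedral if there is a triangulation of $\Delta_{n-1}\times\Delta_{d-1}$ such that the matchings of $M$ are exactly the matchings $G$ with $d$ edges for which $P(G)$ is a simplex of the triangulation. **Statement.** There is a $(6,4)$-matching field $M$ whose graphs $C_\tau$, $|\tau|=5$, are the following (writing $ji$ for the edge $(\ell_j,r_i)$): - $\tau=L\setminus\{\ell_6\}$: $11,22,33,44,51,52,53,54$; - $\tau=L\setminus\{\ell_5\}$: $11,22,33,44,61,62,63,64$; - $\tau=L\setminus\{\ell_4\}$: $11,22,33,51,53,54,62,64$; - $\tau=L\setminus\{\ell_3\}$: $11,22,44,52,53,61,63,64$; - $\tau=L\setminus\{\ell_2\}$: $11,33,44,51,52,54,62,63$; - $\tau=L\setminus\{\ell_1\}$: $22,33,44,51,53,61,62,64$. This $M$ is linkage and is not polyhedral. The polytopes $P(T)$, $T$ a maximal tope of $M$, together with all their faces, form a (nonempty)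 simplicial complex whose maximal simplices all have dimension $5=n-1$ and are interior polytopes, that is, are of the form $P(G)$ and meet the relative interior of $\Delta_5\times\Delta_3$. This complex is not a subcomplex of any triangulation of $\Delta_5\times\Delta_3$. -/

import Mathlib

/-!
Bipartite graphs on `L ⊔ R` with `L = Fin n`, `R = Fin d` are identified with their edge sets.
-/

/-- A bipartite graph on the node set `Fin n ⊔ Fin d`, given by its set of edges `(ℓ, r)`. -/
abbrev BipGraph (n d : ℕ) : Type := Finset (Fin n × Fin d)

namespace BipGraph

variable {n d : ℕ}

/-- Degree of the left node `l`. -/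
def leftDegree (G : BipGraph n d) (l : Fin n) : ℕ := (G.filter fun e => e.1 = l).card

/-- Degree of the right node `r`. -/
def rightDegree (G : BipGraph n d) (r : Fin d) : ℕ := (G.filter fun e => e.2 = r).card

/-- `G` is a tope of type `v` on `σ ⊆ L`: its right degree vector is `v` and its left degree vector
is the characteristic vector of `σ`. -/
def IsTope (v : Fin d → ℕ) (σ : Finset (Fin n)) (G : BipGraph n d) : Prop :=
  (∀ l, G.leftDegree l = if l ∈ σ then 1 else 0) ∧ ∀ r, G.rightDegree r = v r

end BipGraph

/-- An `(n,d)`-tope field: a type `v = (v₁, …, v_d)` of positive integers with sum `k ≤ n` (the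
thickness), and for every `k`-element subset `σ` of `L` a tope of type `v` on `σ`.
(`tope σ` is given the value `∅` on the irrelevant sets `σ` with `|σ| ≠ k`.) -/
structure TopeField (n d : ℕ) where
  type : Fin d → ℕ
  type_pos : ∀ r, 0 < type r
  sum_type_le : ∑ r, type r ≤ n
  tope : Finset (Fin n) → BipGraph n d
  isTope : ∀ σ, σ.card = ∑ r, type r → (tope σ).IsTope type σ
  tope_eq_empty : ∀ σ, σ.card ≠ ∑ r, type r → tope σ = ∅

/-- The vertex `(e_j, e_i)` of `Δ_{n-1} × Δ_{d-1}` that corresponds to the edge `(ℓ_j, r_i)`. -/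
def prodVertex {n d : ℕ} (e : Fin n × Fin d) : (Fin n → ℝ) × (Fin d → ℝ) :=
  (Pi.single e.1 1, Pi.single e.2 1)

/-- The product of simplices `Δ_{n-1} × Δ_{d-1} = conv {(e_j, e_i)}`. -/
def prodSimplices (n d : ℕ) : Set ((Fin n → ℝ) × (Fin d → ℝ)) :=
  stdSimplex ℝ (Fin n) ×ˢ stdSimplex ℝ (Fin d)

namespace BipGraph

variable {n d : ℕ}

/-- The set of vertices of `Δ_{n-1} × Δ_{d-1}` that corresponds to the edges of `G`. -/
noncomputable def vertexSet (G : BipGraph n d) : Finset ((Fin n → ℝ) × (Fin d → ℝ)) :=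
  G.image prodVertex

/-- The subpolytope `P(G)` of `Δ_{n-1} × Δ_{d-1}`. -/
def polytope (G : BipGraph n d) : Set ((Fin n → ℝ) × (Fin d → ℝ)) :=
  convexHull ℝ (G.vertexSet : Set ((Fin n → ℝ) × (Fin d → ℝ)))

/-- `P(G)` is an interior polytope: it meets the (relative) interior of `Δ_{n-1} × Δ_{d-1}`. -/
def IsInteriorPolytope (G : BipGraph n d) : Prop :=
  (G.polytope ∩ intrinsicInterior ℝ (prodSimplices n d)).Nonempty

end BipGraph

/-- `K` is a triangulation of `Δ_{n-1} × Δ_{d-1}`: it covers the product, and its vertices are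
vertices of the product (no new vertices are used). -/
def IsTriangulation {n d : ℕ}
    (K : Geometry.SimplicialComplex ℝ ((Fin n → ℝ) × (Fin d → ℝ))) : Prop :=
  K.vertices ⊆ Set.range prodVertex ∧ K.space = prodSimplices n d

/-- `K` is a pure `m`-dimensional simplicial complex of interior polytopes: there is at least one
maximal simplex, and every maximal simplex has dimension `m` and is an interior polytope `P(G)`. -/
def IsInteriorComplex {n d : ℕ} (m : ℕ)
    (K : Geometry.SimplicialComplex ℝ ((Fin n → ℝ) × (Fin d → ℝ))) : Prop :=
  K.facets.Nonempty ∧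
    ∀ s ∈ K.facets, s.card = m + 1 ∧ ∃ G : BipGraph n d, s = G.vertexSet ∧ G.IsInteriorPolytope

namespace TopeField

variable {n d : ℕ}

/-- A matching field is a tope field of type `(1, …, 1)`. -/
def IsMatchingField (M : TopeField n d) : Prop := M.type = fun _ => 1

/-- The union of all topes on subsets of `τ`.  For a linkage tope field and `|τ| = k + 1` this is the
linkage covector on `τ`. -/
def covector (M : TopeField n d) (τ : Finset (Fin n)) : BipGraph n d :=
  (τ.powersetCard (∑ r, M.type r)).biUnion M.tope

/-- The linkage axiom for a matching field: for every `r ∈ R` and `(d+1)`-subset `τ ⊆ L` there are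
distinct `j, j' ∈ τ` such that `M_{τ∖j}` and `M_{τ∖j'}` agree everywhere other than on `r`. -/
def IsLinkage (M : TopeField n d) : Prop :=
  ∀ (r : Fin d) (τ : Finset (Fin n)), τ.card = d + 1 →
    ∃ j ∈ τ, ∃ j' ∈ τ, j ≠ j' ∧
      (M.tope (τ.erase j)).filter (fun e => e.2 ≠ r) =
        (M.tope (τ.erase j')).filter (fun e => e.2 ≠ r)

/-- A matching field is polyhedral if it is obtained from a triangulation of `Δ_{n-1} × Δ_{d-1}` by
extraction: for some triangulation `K`, its matchings are exactly the matchings of size `d` that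
occur in `K`, that is, that span a simplex of `K` (equivalently, that are contained in the tree
encoding some maximal simplex of `K`). -/
def IsPolyhedral (M : TopeField n d) : Prop :=
  ∃ K : Geometry.SimplicialComplex ℝ ((Fin n → ℝ) × (Fin d → ℝ)), IsTriangulation K ∧
    ∀ σ : Finset (Fin n), σ.card = d → ∀ G : BipGraph n d, G.IsTope (fun _ => 1) σ →
      (G.vertexSet ∈ K.faces ↔ G = M.tope σ)

/-- `N` is the `i`-amalgamation of `M` (type `v`, thickness `k`): `N` has type `v + e_i`, and for
every `(k+1)`-subset `τ` of `L`, `N_τ` is the unique tope of type `v + e_i` on `τ` that is contained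
in the linkage covector of `M` on `τ`. -/
def IsAmalgamation (i : Fin d) (M N : TopeField n d) : Prop :=
  N.type = M.type + Pi.single i 1 ∧
    ∀ τ : Finset (Fin n), τ.card = ∑ r, N.type r →
      ∀ G : BipGraph n d, (G.IsTope N.type τ ∧ G ⊆ M.covector τ) ↔ G = N.tope τ

/-- `T` is a maximal tope of the matching field `M`: it is the single tope of a tope field of
thickness `n` that arises from `M` by iterated amalgamation. -/
def IsMaximalTope (M : TopeField n d) (T : BipGraph n d) : Prop :=
  ∃ N : TopeField n d, Relation.ReflTransGen (fun A B => ∃ i, IsAmalgamation i A B) M N ∧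
    ∑ r, N.type r = n ∧ T = N.tope Finset.univ

/-- The simplices of `Σ(M)`: all (nonempty) faces of the simplices `P(T)`, `T` a maximal tope of
the matching field `M`. -/
def maximalTopeFaces (M : TopeField n d) : Set (Finset ((Fin n → ℝ) × (Fin d → ℝ))) :=
  {s | s.Nonempty ∧ ∃ T : BipGraph n d, M.IsMaximalTope T ∧ s ⊆ T.vertexSet}

end TopeField

/-- The six linkage covectors of the `(6,4)`-example (nodes are numbered from `0`); the `j`-th one is
the covector on all left nodes except `j`. -/
def exampleCovector : Fin 6 → BipGraph 6 4 :=
  ![{(5, 0), (1, 1), (2, 2), (3, 3), (4, 0), (5, 1), (4, 2), (5, 3)},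
    {(0, 0), (5, 1), (2, 2), (3, 3), (4, 0), (4, 1), (5, 2), (4, 3)},
    {(0, 0), (1, 1), (5, 2), (3, 3), (5, 0), (4, 1), (4, 2), (5, 3)},
    {(0, 0), (1, 1), (2, 2), (4, 3), (4, 0), (5, 1), (4, 2), (5, 3)},
    {(0, 0), (1, 1), (2, 2), (3, 3), (5, 0), (5, 1), (5, 2), (5, 3)},
    {(0, 0), (1, 1), (2, 2), (3, 3), (4, 0), (4, 1), (4, 2), (4, 3)}]

/-! All topes are governed by a tournament on the right nodes. `pairs` consists of the diagonal and,
for each two right nodes, exactly one of the two orders, so a multiset of two right nodes determines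
its pair. Every tope involved is the identity on the first four left nodes it uses, with the last
two sent to the entries of a pair. The ten pairs give the ten maximal topes. Uniqueness inside a
covector comes from a potential on the right nodes: the total potential of a tope depends only on
its type, so a tope that minimizes strictly at every left node has no competitor
(`IsTope.eq_of_potential`).

The same argument with real weights shows that two maximal simplices meet in a common face
(`convexHull_inter_subset_of_potential`). A suitable potential could fail to exist only for a pair
and its reversal, and these never both occur unless equal.

The tournament contains the 3-cycle (0,1), (1,2), (2,0). Both a triangulation inducing the matching
field and one extending the complex would contain the corresponding diagonals of the three squares
of a triangular prism, and no triangulation does (`not_isTriangulation_of_cyclic`). -/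

namespace TropicalExample

/-- The pairs `(a, b)` such that `(ℓ₅, r_a), (ℓ₆, r_b)` occur together in a maximal tope. -/
def pairs : Finset (Fin 4 × Fin 4) :=
  {(0, 0), (1, 1), (2, 2), (3, 3), (0, 1), (2, 0), (0, 3), (1, 2), (3, 1), (2, 3)}

/-- The left-to-right map that is the identity on the first four nodes and sends the last two
nodes to `p.1` and `p.2`. -/
def target (p : Fin 4 × Fin 4) : Fin 6 → Fin 4 := ![0, 1, 2, 3, p.1, p.2]

/-- The restriction to `σ` of the graph of `target p`. -/
def graphOn (σ : Finset (Fin 6)) (p : Fin 4 × Fin 4) : BipGraph 6 4 :=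
  σ.image fun l => (l, target p l)

/-- `target p` takes on `σ` each value `r` exactly `v r` times. -/
def Fits (v : Fin 4 → ℕ) (σ : Finset (Fin 6)) (p : Fin 4 × Fin 4) : Prop :=
  ∀ r, (σ.filter fun l => target p l = r).card = v r

instance (v : Fin 4 → ℕ) (σ : Finset (Fin 6)) : DecidablePred (Fits v σ) :=
  fun p => inferInstanceAs (Decidable (∀ r, (σ.filter fun l => target p l = r).card = v r))

/-- The tope of type `v` on `σ`. -/
def topeOn (v : Fin 4 → ℕ) (σ : Finset (Fin 6)) : BipGraph 6 4 :=
  -- If `σ` misses one of the last two left nodes, several pairs may fit, but their graphs agree on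
  -- `σ`; otherwise at most one pair fits.
  (pairs.filter (Fits v σ)).biUnion (graphOn σ)

instance (v : Fin 4 → ℕ) (σ : Finset (Fin 6)) (G : BipGraph 6 4) : Decidable (G.IsTope v σ) :=
  inferInstanceAs (Decidable (_ ∧ _))

/-- The type of the matching field. -/
def type₀ : Fin 4 → ℕ := fun _ => 1

/-- The type of the `i`-amalgamation. -/
def type₁ (i : Fin 4) : Fin 4 → ℕ := type₀ + Pi.single i 1

/-- The type of the `j`-amalgamation of the `i`-amalgamation. -/
def type₂ (i j : Fin 4) : Fin 4 → ℕ := type₁ i + Pi.single j 1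

end TropicalExample

/-! ### Uniqueness of topes and of amalgamations -/

namespace BipGraph

variable {n d : ℕ}

theorem IsTope.exists_eq_image [NeZero d] {v : Fin d → ℕ} {τ : Finset (Fin n)} {G : BipGraph n d}
    (hG : G.IsTope v τ) : ∃ g : Fin n → Fin d, G = τ.image fun l => (l, g l) := by
  have h : ∀ l, ∃ r, l ∈ τ → G.filter (fun e => e.1 = l) = {(l, r)} := by
    intro l
    by_cases hl : l ∈ τ
    · have h1 := hG.1 l
      rw [if_pos hl, leftDegree, Finset.card_eq_one] at h1
      obtain ⟨⟨a, r⟩, he⟩ := h1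
      have hmem : (a, r) ∈ G.filter (fun e => e.1 = l) := by rw [he]; simp
      have ha : a = l := (Finset.mem_filter.1 hmem).2
      subst ha
      exact ⟨r, fun _ => he⟩
    -- Outside `τ` the value is arbitrary.
    · exact ⟨0, fun h => absurd h hl⟩
  choose g hg using h
  refine ⟨g, Finset.ext ?_⟩
  rintro ⟨l, r⟩
  by_cases hl : l ∈ τ
  · have : (l, r) ∈ G ↔ (l, r) ∈ G.filter (fun e => e.1 = l) := by simp
    rw [this, hg l hl]
    simp only [Finset.mem_singleton, Prod.mk.injEq, true_and, Finset.mem_image]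
    exact ⟨fun h => ⟨l, hl, rfl, h.symm⟩, by rintro ⟨a, _, rfl, rfl⟩; rfl⟩
  · have h0 := hG.1 l
    rw [if_neg hl, leftDegree, Finset.card_eq_zero, Finset.filter_eq_empty_iff] at h0
    refine ⟨fun h => absurd rfl (h0 h), fun h => ?_⟩
    obtain ⟨a, ha, hae⟩ := Finset.mem_image.1 h
    rw [Prod.mk.injEq] at hae
    exact absurd (hae.1 ▸ ha) hl

theorem IsTope.sum_eq {v : Fin d → ℕ} {τ : Finset (Fin n)} {G : BipGraph n d}
    (hG : G.IsTope v τ) (h : Fin d → ℕ) : ∑ e ∈ G, h e.2 = ∑ r, v r * h r := by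
  rw [← Finset.sum_fiberwise_of_maps_to (fun e _ => Finset.mem_univ e.2)]
  refine Finset.sum_congr rfl fun r _ => ?_
  rw [Finset.sum_congr rfl (g := fun _ => h r)
    (fun e he => by rw [(Finset.mem_filter.1 he).2]), Finset.sum_const, smul_eq_mul, ← hG.2 r,
    rightDegree]

/-- If the potential `h` strictly increases from the edges of the tope `T` to the other edges of `C`
at the same left node, then `T` is the only tope of its type on `τ` that is contained in `C`. -/
theorem IsTope.eq_of_potential [NeZero d] {v : Fin d → ℕ} {τ : Finset (Fin n)}
    {T G C : BipGraph n d} (hT : T.IsTope v τ) (hG : G.IsTope v τ) (hGC : G ⊆ C) (h : Fin d → ℕ)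
    (hh : ∀ e ∈ T, ∀ e' ∈ C, e.1 = e'.1 → e' ∉ T → h e.2 < h e'.2) : G = T := by
  have sT := hT.sum_eq h
  rw [← hG.sum_eq h] at sT
  obtain ⟨t, rfl⟩ := hT.exists_eq_image
  obtain ⟨g, rfl⟩ := hG.exists_eq_image
  have inj : ∀ f : Fin n → Fin d, Function.Injective fun l => (l, f l) :=
    fun f a b hab => congrArg Prod.fst hab
  rw [Finset.sum_image fun _ _ _ _ hab => inj t hab,
    Finset.sum_image fun _ _ _ _ hab => inj g hab] at sT
  have key : ∀ l ∈ τ, g l ≠ t l → h (t l) < h (g l) := by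
    intro l hl hne
    refine hh (l, t l) (Finset.mem_image_of_mem _ hl) (l, g l)
      (hGC (Finset.mem_image_of_mem _ hl)) rfl fun hmem => ?_
    obtain ⟨a, _, ha⟩ := Finset.mem_image.1 hmem
    rw [Prod.mk.injEq] at ha
    obtain ⟨rfl, ha⟩ := ha
    exact hne ha.symm
  refine Finset.image_congr fun l hl => ?_
  by_contra hne
  have hne' : g l ≠ t l := fun h' => hne (by simp [h'])
  -- A single disagreement makes the total potential of `G` strictly larger, although both topes
  -- have the same type.
  refine (Finset.sum_lt_sum (fun i hi => ?_) ⟨l, hl, key l hl hne'⟩).ne sT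
  by_cases hi' : g i = t i
  · rw [hi']
  · exact (key i hi hi').le

end BipGraph

namespace TopeField

variable {n d : ℕ}

theorem IsAmalgamation.unique {i : Fin d} {M N N' : TopeField n d} (h : IsAmalgamation i M N)
    (h' : IsAmalgamation i M N') : N = N' := by
  have ht : N.type = N'.type := h.1.trans h'.1.symm
  have htope : N.tope = N'.tope := by
    funext τ
    by_cases hτ : τ.card = ∑ r, N.type r
    · have := ((h.2 τ hτ (N.tope τ)).2 rfl)
      rw [ht] at this hτ
      exact (h'.2 τ hτ _).1 this
    -- The default value `∅` off the thickness is what makes the two fields literally equal.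
    · rw [N.tope_eq_empty τ hτ, N'.tope_eq_empty τ (ht ▸ hτ)]
  cases N; cases N'
  simp only at ht htope
  subst ht htope
  rfl

theorem IsAmalgamation.sum_type {i : Fin d} {M N : TopeField n d} (h : IsAmalgamation i M N) :
    ∑ r, N.type r = ∑ r, M.type r + 1 := by
  rw [h.1]
  simp [Finset.sum_add_distrib]

end TopeField

/-! ### The matching field and its iterated amalgamations -/

namespace TropicalExample

/-- The tope field of type `v` whose topes are `topeOn v σ`. -/
def field (v : Fin 4 → ℕ) (hpos : ∀ r, 0 < v r) (hle : ∑ r, v r ≤ 6)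
    (h : ∀ σ, σ.card = ∑ r, v r → (topeOn v σ).IsTope v σ) : TopeField 6 4 where
  type := v
  type_pos := hpos
  sum_type_le := hle
  tope σ := if σ.card = ∑ r, v r then topeOn v σ else ∅
  isTope σ hσ := by rw [if_pos hσ]; exact h σ hσ
  tope_eq_empty σ hσ := if_neg hσ

set_option maxRecDepth 100000

/-- The `(6,4)`-matching field. -/
def matchingField : TopeField 6 4 :=
  field type₀ (by decide) (by decide) (by decide +kernel)

/-- The `i`-amalgamation of `matchingField`. -/
def amalgamation (i : Fin 4) : TopeField 6 4 :=
  field (type₁ i) (by revert i; decide) (by revert i; decide) (by revert i; decide +kernel)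

/-- The `j`-amalgamation of the `i`-amalgamation of `matchingField`. -/
def amalgamation₂ (i j : Fin 4) : TopeField 6 4 :=
  field (type₂ i j) (by revert i j; decide) (by revert i j; decide) (by revert i j; decide +kernel)

theorem covector_matchingField :
    ∀ j, matchingField.covector (Finset.univ.erase j) = exampleCovector j := by
  decide +kernel

theorem isLinkage_matchingField : matchingField.IsLinkage := by
  unfold TopeField.IsLinkage
  decide +kernel

/-- Distance from `i` in the linkage covector `exampleCovector j`. -/
def potential (i : Fin 4) (j : Fin 6) (r : Fin 4) : ℕ :=
  if r = i then 0
  else if ∃ l ∈ ({4, 5} : Finset (Fin 6)), (l, r) ∈ exampleCovector j ∧ (l, i) ∈ exampleCovector j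
    then 1
  else 2

theorem tope_amalgamation_subset : ∀ i j,
    (amalgamation i).tope (Finset.univ.erase j) ⊆ exampleCovector j := by
  decide +kernel

/-- Each left node of the amalgamated tope uses its unique edge nearest to `i`. The contrapositive
form matches the hypothesis of `IsTope.eq_of_potential`. -/
theorem potential_lt : ∀ i j, ∀ e ∈ exampleCovector j, ∀ e' ∈ exampleCovector j, e.1 = e'.1 →
    potential i j e'.2 ≤ potential i j e.2 →
    e ∈ (amalgamation i).tope (Finset.univ.erase j) →
      e' ∈ (amalgamation i).tope (Finset.univ.erase j) := by
  decide +kernel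

/-- The element of `pairs` with entries `i` and `j`. -/
def orderedPair (i j : Fin 4) : Fin 4 × Fin 4 := if (i, j) ∈ pairs then (i, j) else (j, i)

theorem orderedPair_mem : ∀ i j, orderedPair i j ∈ pairs := by decide

theorem orderedPair_eq : ∀ p ∈ pairs, orderedPair p.1 p.2 = p := by decide

theorem tope_amalgamation₂ : ∀ i j,
    (amalgamation₂ i j).tope Finset.univ = graphOn Finset.univ (orderedPair i j) := by
  decide +kernel

theorem covector_amalgamation : ∀ i, (amalgamation i).covector Finset.univ =
    (pairs.filter fun p => p.1 = i ∨ p.2 = i).biUnion (graphOn Finset.univ) := by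
  decide +kernel

/-- Distance from `{i, j}` in the linkage covector of the `i`-amalgamation. -/
def potential₂ (i j r : Fin 4) : ℕ := if r = j then 0 else if r = i then 1 else 2

/-- Failure would require `p` to have `j` where `orderedPair i j` has `i ≠ j`. Since `p` also
contains `i`, it would be the reversed pair, which is not in `pairs`. -/
theorem potential₂_lt : ∀ i j, ∀ p ∈ pairs, p.1 = i ∨ p.2 = i → ∀ l,
    target (orderedPair i j) l ≠ target p l →
      potential₂ i j (target (orderedPair i j) l) < potential₂ i j (target p l) := by
  decide +kernel

theorem sum_type_matchingField : ∑ r, matchingField.type r = 4 := by decide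

theorem sum_type_amalgamation : ∀ i, ∑ r, (amalgamation i).type r = 5 := by decide

theorem sum_type_amalgamation₂ : ∀ i j, ∑ r, (amalgamation₂ i j).type r = 6 := by decide

theorem isAmalgamation₁ (i : Fin 4) :
    TopeField.IsAmalgamation i matchingField (amalgamation i) := by
  refine ⟨rfl, fun τ hτ G => ?_⟩
  obtain ⟨j, rfl⟩ : ∃ j, τ = Finset.univ.erase j := by
    have : τᶜ.card = 1 := by rw [Finset.card_compl, hτ, sum_type_amalgamation]; rfl
    obtain ⟨j, hj⟩ := Finset.card_eq_one.1 this
    exact ⟨j, by rw [← compl_compl τ, hj]; ext; simp⟩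
  rw [covector_matchingField]
  have hT := (amalgamation i).isTope _ hτ
  have hsub := tope_amalgamation_subset i j
  constructor
  · rintro ⟨hG, hGC⟩
    refine hT.eq_of_potential hG hGC (potential i j) fun e he e' he' h h' => ?_
    by_contra hlt
    exact h' (potential_lt i j e (hsub he) e' he' h (not_lt.1 hlt) he)
  · rintro rfl
    exact ⟨hT, hsub⟩

theorem isAmalgamation₂ (i j : Fin 4) :
    TopeField.IsAmalgamation j (amalgamation i) (amalgamation₂ i j) := by
  refine ⟨rfl, fun τ hτ G => ?_⟩
  obtain rfl : τ = Finset.univ :=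
    (Finset.card_eq_iff_eq_univ τ).1 (hτ.trans (sum_type_amalgamation₂ i j))
  have hT := (amalgamation₂ i j).isTope _ hτ
  rw [covector_amalgamation]
  constructor
  · rintro ⟨hG, hGC⟩
    refine hT.eq_of_potential hG hGC (potential₂ i j) fun e he e' he' h h' => ?_
    rw [tope_amalgamation₂] at he h'
    obtain ⟨l, _, rfl⟩ := Finset.mem_image.1 he
    obtain ⟨p, hp, hep⟩ := Finset.mem_biUnion.1 he'
    obtain ⟨l', _, rfl⟩ := Finset.mem_image.1 hep
    obtain rfl : l = l' := h
    rw [Finset.mem_filter] at hp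
    refine potential₂_lt i j p hp.1 hp.2 l fun heq => h' ?_
    rw [← heq]
    exact he
  · rintro rfl
    refine ⟨hT, ?_⟩
    rw [tope_amalgamation₂]
    refine Finset.subset_biUnion_of_mem _ (Finset.mem_filter.2 ⟨orderedPair_mem i j, ?_⟩)
    revert i j
    decide

/-- Amalgamations are unique and raise the thickness by one, so thickness 6 is reached from 4 in
exactly two steps. -/
theorem isMaximalTope_iff (T : BipGraph 6 4) :
    matchingField.IsMaximalTope T ↔ ∃ p ∈ pairs, T = graphOn Finset.univ p := by
  constructor
  · rintro ⟨N, hN, h6, rfl⟩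
    rcases hN.cases_head with rfl | ⟨A, ⟨i, hA⟩, hN⟩
    · simp [sum_type_matchingField] at h6
    obtain rfl := hA.unique (isAmalgamation₁ i)
    rcases hN.cases_head with rfl | ⟨B, ⟨j, hB⟩, hN⟩
    · simp [sum_type_amalgamation] at h6
    obtain rfl := hB.unique (isAmalgamation₂ i j)
    rcases hN.cases_head with rfl | ⟨D, ⟨k, hD⟩, -⟩
    · exact ⟨_, orderedPair_mem i j, tope_amalgamation₂ i j⟩
    · have h7 := D.sum_type_le
      have := sum_type_amalgamation₂ i j
      have := hD.sum_type
      omega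
  · rintro ⟨p, hp, rfl⟩
    refine ⟨amalgamation₂ p.1 p.2, .tail (.single ⟨_, isAmalgamation₁ _⟩) ⟨_, isAmalgamation₂ _ _⟩,
      sum_type_amalgamation₂ _ _, ?_⟩
    rw [tope_amalgamation₂, orderedPair_eq p hp]

end TropicalExample

/-! ### Simplices spanned by graphs of functions -/

theorem mem_intrinsicInterior_stdSimplex {ι : Type*} [Fintype ι] {x : ι → ℝ}
    (hx : x ∈ stdSimplex ℝ ι) (hpos : ∀ i, 0 < x i) :
    x ∈ intrinsicInterior ℝ (stdSimplex ℝ ι) := by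
  refine mem_intrinsicInterior.2 ⟨⟨x, subset_affineSpan ℝ _ hx⟩, mem_interior.2
    ⟨{y | ∀ i, 0 < (y : ι → ℝ) i}, fun y hy => ⟨fun i => (hy i).le, ?_⟩, ?_, hpos⟩, rfl⟩
  · refine affineSpan_induction (p := fun z : ι → ℝ => ∑ i, z i = 1) y.2 (fun z hz => hz.2) ?_
    intro c u v w hu hv hw
    simp [Finset.sum_add_distrib, ← Finset.mul_sum, hu, hv, hw]
  · simp only [Set.ofPred_forall]
    exact isOpen_iInter_of_finite fun i =>
      isOpen_lt continuous_const ((continuous_apply i).comp continuous_subtype_val)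

/-- The points `(e_j, e_{f j})`, `j = 1, …, n`. -/
noncomputable def graphVertex {n d : ℕ} (f : Fin n → Fin d) (l : Fin n) :
    (Fin n → ℝ) × (Fin d → ℝ) := prodVertex (l, f l)

theorem linearIndependent_graphVertex {n d : ℕ} (f : Fin n → Fin d) :
    LinearIndependent ℝ (graphVertex f) :=
  .of_comp (LinearMap.fst ℝ (Fin n → ℝ) (Fin d → ℝ)) (Pi.linearIndependent_single_one (Fin n) ℝ)

theorem prodVertex_injective {n d : ℕ} :
    Function.Injective (prodVertex : Fin n × Fin d → (Fin n → ℝ) × (Fin d → ℝ)) := by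
  rintro ⟨a, b⟩ ⟨a', b'⟩ h
  have h1 := congrFun (congrArg Prod.fst h) a
  have h2 := congrFun (congrArg Prod.snd h) b
  simp only [prodVertex, Pi.single_eq_same, Pi.single_apply] at h1 h2
  split_ifs at h1 h2 with ha hb <;> simp_all

theorem exists_weights_of_mem_convexHull {ι E : Type*} [Fintype ι] [DecidableEq ι] [DecidableEq E]
    [AddCommGroup E] [Module ℝ E] {F : ι → E} (hF : Function.Injective F) {s : Finset E}
    (hs : s ⊆ Finset.univ.image F) {x : E} (hx : x ∈ convexHull ℝ (s : Set E)) :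
    ∃ w : ι → ℝ, (∀ i, 0 ≤ w i) ∧ (∀ i, w i ≠ 0 → F i ∈ s) ∧ ∑ i, w i = 1 ∧
      x = ∑ i, w i • F i := by
  obtain ⟨w, h0, h1, rfl⟩ := Finset.mem_convexHull'.1 hx
  obtain ⟨t, -, rfl⟩ := Finset.subset_image_iff.1 hs
  rw [Finset.sum_image fun _ _ _ _ h => hF h] at h1
  refine ⟨fun i => if i ∈ t then w (F i) else 0, fun i => ?_, fun i hi => ?_, ?_, ?_⟩
  · dsimp only
    split_ifs with h
    exacts [h0 _ (Finset.mem_image_of_mem F h), le_rfl]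
  · by_contra h
    exact hi (if_neg fun hit => h (Finset.mem_image_of_mem F hit))
  · simpa using h1
  · rw [Finset.sum_image fun _ _ _ _ h => hF h]
    simp [ite_smul]

section ConvexHull

variable {n d : ℕ} {f g : Fin n → Fin d} {s t : Finset ((Fin n → ℝ) × (Fin d → ℝ))}
  {x : (Fin n → ℝ) × (Fin d → ℝ)}

theorem graphVertex_coordinates (hs : s ⊆ Finset.univ.image (graphVertex f))
    (hx : x ∈ convexHull ℝ (s : Set ((Fin n → ℝ) × (Fin d → ℝ)))) :
    (∀ l, 0 ≤ x.1 l) ∧ (∀ l, x.1 l ≠ 0 → graphVertex f l ∈ s) ∧ ∑ l, x.1 l = 1 ∧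
      x = ∑ l, x.1 l • graphVertex f l := by
  obtain ⟨w, h0, hs, h1, rfl⟩ :=
    exists_weights_of_mem_convexHull (linearIndependent_graphVertex f).injective hs hx
  have key : ∀ l, (∑ k, w k • graphVertex f k).1 l = w l := by
    intro l
    simp [Prod.fst_sum, Finset.sum_apply, graphVertex, prodVertex, Pi.single_apply]
  simp_rw [key]
  exact ⟨h0, hs, h1, trivial⟩

/-- If some potential `h` on the right nodes increases strictly from `f` to `g` wherever `f` and `g`
differ, then the simplices spanned by the graphs of `f` and `g` intersect in a common face. -/
theorem convexHull_inter_subset_of_potential (hs : s ⊆ Finset.univ.image (graphVertex f))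
    (ht : t ⊆ Finset.univ.image (graphVertex g)) (h : Fin d → ℝ)
    (hh : ∀ l, f l ≠ g l → h (f l) < h (g l)) :
    convexHull ℝ (s : Set ((Fin n → ℝ) × (Fin d → ℝ))) ∩ convexHull ℝ t ⊆
      convexHull ℝ (s ∩ t : Set ((Fin n → ℝ) × (Fin d → ℝ))) := by
  rintro x ⟨hxs, hxt⟩
  obtain ⟨x0, xs, x1, xf⟩ := graphVertex_coordinates hs hxs
  obtain ⟨-, xt, -, xg⟩ := graphVertex_coordinates ht hxt
  have value : ∀ k : Fin n → Fin d, x = ∑ l, x.1 l • graphVertex k l →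
      ∑ r, x.2 r * h r = ∑ l, x.1 l * h (k l) := by
    intro k hk
    have h2 : ∀ r, x.2 r = ∑ l, x.1 l * (if k l = r then 1 else 0) := by
      intro r
      conv_lhs => rw [hk]
      rw [Prod.snd_sum, Finset.sum_apply]
      exact Finset.sum_congr rfl fun l _ => by
        simp [graphVertex, prodVertex, Pi.single_apply, eq_comm]
    simp_rw [h2, Finset.sum_mul]
    rw [Finset.sum_comm]
    exact Finset.sum_congr rfl fun l _ => by simp
  have hle : ∀ l, x.1 l * h (f l) ≤ x.1 l * h (g l) := by
    intro l
    by_cases hl : f l = g l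
    · rw [hl]
    · exact mul_le_mul_of_nonneg_left (hh l hl).le (x0 l)
  -- The coordinates `x.1` are the barycentric weights in both simplices, so both sums equal the
  -- potential of `x.2`. Termwise inequality then forces termwise equality.
  have heq := (Finset.sum_eq_sum_iff_of_le fun l _ => hle l).1 ((value f xf).symm.trans (value g xg))
  have hfg : ∀ l, x.1 l ≠ 0 → f l = g l := by
    intro l hl
    by_contra hne
    exact (hh l hne).ne (mul_left_cancel₀ hl (heq l (Finset.mem_univ l)))
  rw [xf, ← Finset.sum_filter_of_ne (p := fun l => x.1 l ≠ 0)
    (fun l _ hl h0 => hl (by rw [h0, zero_smul]))]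
  refine (convex_convexHull ℝ _).sum_mem (fun l _ => x0 l) ?_ fun l hl => ?_
  · rw [← x1]
    exact Finset.sum_filter_ne_zero _
  · have hl := (Finset.mem_filter.1 hl).2
    refine subset_convexHull ℝ _ ⟨xs l hl, ?_⟩
    have := xt l hl
    rwa [graphVertex, ← hfg l hl] at this

theorem affineIndependent_of_subset_graphVertex (hs : s ⊆ Finset.univ.image (graphVertex f)) :
    AffineIndependent ℝ ((↑) : s → (Fin n → ℝ) × (Fin d → ℝ)) :=
  (linearIndependent_graphVertex f).affineIndependent.range.mono fun x hx => by
    obtain ⟨l, -, rfl⟩ := Finset.mem_image.1 (hs hx)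
    exact ⟨l, rfl⟩

end ConvexHull

/-- In a geometric simplicial complex the two diagonals of a square face of `Δ × Δ` do not both
occur. -/
theorem not_mem_faces_of_diagonal {n d : ℕ}
    {K : Geometry.SimplicialComplex ℝ ((Fin n → ℝ) × (Fin d → ℝ))} {j k : Fin n} {a b : Fin d}
    (hjk : j ≠ k) (hab : a ≠ b) (h : {prodVertex (j, a), prodVertex (k, b)} ∈ K.faces) :
    ({prodVertex (j, b), prodVertex (k, a)} : Finset ((Fin n → ℝ) × (Fin d → ℝ))) ∉ K.faces := by
  intro h'
  have hsum : (prodVertex (j, a) : (Fin n → ℝ) × (Fin d → ℝ)) + prodVertex (k, b) =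
      prodVertex (j, b) + prodVertex (k, a) := by
    simp only [prodVertex, Prod.mk_add_mk, Prod.mk.injEq, true_and]
    exact add_comm _ _
  have hmem : ∀ y z : (Fin n → ℝ) × (Fin d → ℝ), (1 / 2 : ℝ) • (y + z) ∈
      convexHull ℝ (({y, z} : Finset ((Fin n → ℝ) × (Fin d → ℝ))) : Set _) := by
    intro y z
    rw [smul_add]
    exact convex_convexHull ℝ _ (subset_convexHull ℝ _ (by simp))
      (subset_convexHull ℝ _ (by simp)) (by norm_num) (by norm_num) (by norm_num)
  have hdisj : ({prodVertex (j, a), prodVertex (k, b)} : Finset ((Fin n → ℝ) × (Fin d → ℝ))) ∩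
      {prodVertex (j, b), prodVertex (k, a)} = ∅ := by
    rw [← Finset.disjoint_iff_inter_eq_empty, Finset.disjoint_left]
    simp [prodVertex_injective.eq_iff, hjk, hab, hjk.symm, hab.symm]
  -- The diagonals share their midpoint but no vertex.
  have hmid := K.inter_subset_convexHull h h' ⟨hmem _ _, hsum ▸ hmem _ _⟩
  rw [← Finset.coe_inter, hdisj] at hmid
  simp at hmid

/-! ### The cyclic prism obstruction -/

namespace TropicalExample

/-- No triangulation of `Δ₅ × Δ₃` contains the cyclic choice of diagonals in the three square faces
of the prism `conv {e₅, e₆} × conv {e₁, e₂, e₃}`. -/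
theorem not_isTriangulation_of_cyclic
    {K : Geometry.SimplicialComplex ℝ ((Fin 6 → ℝ) × (Fin 4 → ℝ))}
    (h01 : {prodVertex (4, 0), prodVertex (5, 1)} ∈ K.faces)
    (h12 : {prodVertex (4, 1), prodVertex (5, 2)} ∈ K.faces)
    (h20 : {prodVertex (4, 2), prodVertex (5, 0)} ∈ K.faces) : ¬ IsTriangulation K := by
  rintro ⟨hvert, hspace⟩
  -- The barycentre of the prism.
  have hx : ((![0, 0, 0, 0, 1 / 2, 1 / 2], ![1 / 3, 1 / 3, 1 / 3, 0]) :
      (Fin 6 → ℝ) × (Fin 4 → ℝ)) ∈ K.space := by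
    rw [hspace]
    refine ⟨⟨fun i => ?_, ?_⟩, ⟨fun i => ?_, ?_⟩⟩
    · fin_cases i <;> norm_num
    · norm_num [Fin.sum_univ_succ]
    · fin_cases i <;> norm_num
    · norm_num [Fin.sum_univ_succ]
  obtain ⟨s, hs, hxs⟩ := Geometry.SimplicialComplex.mem_space_iff.1 hx
  have hsub : s ⊆ Finset.univ.image prodVertex := by
    intro y hy
    obtain ⟨e, rfl⟩ := hvert (K.down_closed hs (Finset.singleton_subset_iff.2 hy) (by simp))
    exact Finset.mem_image_of_mem _ (Finset.mem_univ e)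
  obtain ⟨w, h0, hw, -, hsum⟩ := exists_weights_of_mem_convexHull prodVertex_injective hsub hxs
  have hrow : ∀ l : Fin 6, ∑ r, w (l, r) = (![0, 0, 0, 0, 1 / 2, 1 / 2] : Fin 6 → ℝ) l := by
    intro l
    have := congrFun (congrArg Prod.fst hsum) l
    rw [Prod.fst_sum, Finset.sum_apply, Fintype.sum_prod_type_right] at this
    simpa [prodVertex, Pi.single_apply] using this.symm
  have hcol : ∀ r : Fin 4, ∑ l, w (l, r) = (![1 / 3, 1 / 3, 1 / 3, 0] : Fin 4 → ℝ) r := by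
    intro r
    have := congrFun (congrArg Prod.snd hsum) r
    rw [Prod.snd_sum, Finset.sum_apply, Fintype.sum_prod_type] at this
    simpa [prodVertex, Pi.single_apply] using this.symm
  have hzero : ∀ a b : Fin 4, a ≠ b → {prodVertex (4, a), prodVertex (5, b)} ∈ K.faces →
      w (4, b) = 0 ∨ w (5, a) = 0 := by
    intro a b hab hface
    by_contra! hne
    exact not_mem_faces_of_diagonal (by decide) hab hface
      (K.down_closed hs (by simp [Finset.insert_subset_iff, hw _ hne.1, hw _ hne.2]) (by simp))
  have z01 := hzero 0 1 (by decide) h01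
  have z12 := hzero 1 2 (by decide) h12
  have z20 := hzero 2 0 (by decide) h20
  have hleft : ∀ l : Fin 6, l < 4 → ∀ r, w (l, r) = 0 := by
    intro l hl r
    have hl0 : (![0, 0, 0, 0, 1 / 2, 1 / 2] : Fin 6 → ℝ) l = 0 := by
      fin_cases l <;> first | rfl | exact absurd hl (by decide)
    exact (Finset.sum_eq_zero_iff_of_nonneg fun r _ => h0 (l, r)).1 ((hrow l).trans hl0) r
      (Finset.mem_univ r)
  have hcol' : ∀ r : Fin 4, w (4, r) + w (5, r) = (![1 / 3, 1 / 3, 1 / 3, 0] : Fin 4 → ℝ) r := by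
    intro r
    rw [← hcol r, Fin.sum_univ_six, hleft 0 (by decide), hleft 1 (by decide), hleft 2 (by decide),
      hleft 3 (by decide)]
    ring
  have r4 := hrow 4
  have r5 := hrow 5
  have c0 := hcol' 0
  have c1 := hcol' 1
  have c2 := hcol' 2
  have c3 := hcol' 3
  simp only [Fin.sum_univ_four, Matrix.cons_val] at r4 r5 c0 c1 c2 c3
  have n40 := h0 (4, 0)
  have n41 := h0 (4, 1)
  have n42 := h0 (4, 2)
  have n43 := h0 (4, 3)
  have n50 := h0 (5, 0)
  have n51 := h0 (5, 1)
  have n52 := h0 (5, 2)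
  have n53 := h0 (5, 3)
  -- Two of the three vanishing weights lie in the same row, in different columns. That row then has
  -- total at most 1/3 instead of 1/2.
  rcases z01 with z01 | z01 <;> rcases z12 with z12 | z12 <;> rcases z20 with z20 | z20 <;> linarith

/-! ### The complex of maximal topes -/

theorem vertexSet_graphOn (p : Fin 4 × Fin 4) :
    (graphOn Finset.univ p).vertexSet = Finset.univ.image (graphVertex (target p)) :=
  Finset.image_image

theorem mem_maximalTopeFaces {s : Finset ((Fin 6 → ℝ) × (Fin 4 → ℝ))} :
    s ∈ matchingField.maximalTopeFaces ↔
      s.Nonempty ∧ ∃ p ∈ pairs, s ⊆ Finset.univ.image (graphVertex (target p)) := by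
  simp only [TopeField.maximalTopeFaces, Set.mem_ofPred_eq, isMaximalTope_iff]
  refine and_congr_right fun _ => ⟨?_, ?_⟩
  · rintro ⟨_, ⟨p, hp, rfl⟩, hs⟩
    exact ⟨p, hp, vertexSet_graphOn p ▸ hs⟩
  · rintro ⟨p, hp, hs⟩
    exact ⟨_, ⟨p, hp, rfl⟩, (vertexSet_graphOn p).symm ▸ hs⟩

/-- The constraints are at most two arcs, `p.1 → q.1` and `p.2 → q.2`. They form a cycle only if `q`
is the reversal of `p` with distinct entries, which `pairs` excludes. -/
theorem exists_potential_pair : ∀ p ∈ pairs, ∀ q ∈ pairs, ∃ h : Fin 4 → Fin 4, ∀ l,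
    target p l ≠ target q l → h (target p l) < h (target q l) := by
  decide +kernel

/-- The simplicial complex formed by the faces of the maximal topes. -/
def maximalTopeComplex : Geometry.SimplicialComplex ℝ ((Fin 6 → ℝ) × (Fin 4 → ℝ)) where
  faces := matchingField.maximalTopeFaces
  isRelLowerSet_faces := fun s hs => ⟨hs.1, fun t hts ht => by
    obtain ⟨-, T, hT, hsT⟩ := hs
    exact ⟨ht, T, hT, hts.trans hsT⟩⟩
  indep := fun hs => by
    obtain ⟨-, p, -, hs⟩ := mem_maximalTopeFaces.1 hs
    exact affineIndependent_of_subset_graphVertex hs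
  inter_subset_convexHull := fun hs ht => by
    obtain ⟨-, p, hp, hs⟩ := mem_maximalTopeFaces.1 hs
    obtain ⟨-, q, hq, ht⟩ := mem_maximalTopeFaces.1 ht
    obtain ⟨h, hh⟩ := exists_potential_pair p hp q hq
    exact convexHull_inter_subset_of_potential hs ht (fun r => ((h r : ℕ) : ℝ))
      fun l hl => by exact_mod_cast hh l hl

theorem card_image_graphVertex (p : Fin 4 × Fin 4) :
    (Finset.univ.image (graphVertex (target p))).card = 6 := by
  rw [Finset.card_image_of_injective _ (linearIndependent_graphVertex _).injective]
  rfl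

theorem target_surjective (p : Fin 4 × Fin 4) : Function.Surjective (target p) := by
  intro r
  fin_cases r
  exacts [⟨0, rfl⟩, ⟨1, rfl⟩, ⟨2, rfl⟩, ⟨3, rfl⟩]

theorem isInteriorPolytope_graphOn (p : Fin 4 × Fin 4) :
    (graphOn Finset.univ p).IsInteriorPolytope := by
  have hmem : ∀ l, graphVertex (target p) l ∈ (graphOn Finset.univ p).polytope := fun l =>
    subset_convexHull ℝ _ (by
      rw [vertexSet_graphOn]
      exact Finset.mem_coe.2 (Finset.mem_image_of_mem _ (Finset.mem_univ l)))
  -- The barycentre is interior because every left and every right node has an edge.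
  refine ⟨∑ l, (1 / 6 : ℝ) • graphVertex (target p) l,
    (convex_convexHull ℝ _).sum_mem (fun _ _ => by norm_num) (by simp) fun l _ => hmem l, ?_⟩
  have h1 : (∑ l, (1 / 6 : ℝ) • graphVertex (target p) l).1 = fun _ => 1 / 6 := by
    funext l
    simp [Prod.fst_sum, Finset.sum_apply, graphVertex, prodVertex, Pi.single_apply]
  have h2 : ∀ r, (∑ l, (1 / 6 : ℝ) • graphVertex (target p) l).2 r =
      ∑ l, if r = target p l then 1 / 6 else 0 := by
    intro r
    simp [Prod.snd_sum, Finset.sum_apply, graphVertex, prodVertex, Pi.single_apply]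
  rw [prodSimplices, intrinsicInterior_prod_eq]
  refine ⟨mem_intrinsicInterior_stdSimplex ⟨fun l => ?_, ?_⟩ fun l => ?_,
    mem_intrinsicInterior_stdSimplex ⟨fun r => ?_, ?_⟩ fun r => ?_⟩
  · rw [h1]; norm_num
  · rw [h1]; norm_num
  · rw [h1]; norm_num
  · rw [h2]
    exact Finset.sum_nonneg fun l _ => by split_ifs <;> norm_num
  · simp_rw [h2]
    rw [Finset.sum_comm]
    simp
  · rw [h2]
    obtain ⟨l, rfl⟩ := target_surjective p r
    exact Finset.sum_pos' (fun l _ => by split_ifs <;> norm_num) ⟨l, Finset.mem_univ l, by norm_num⟩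

theorem image_graphVertex_mem_faces {p : Fin 4 × Fin 4} (hp : p ∈ pairs) :
    Finset.univ.image (graphVertex (target p)) ∈ maximalTopeComplex.faces :=
  mem_maximalTopeFaces.2 ⟨Finset.univ_nonempty.image _, p, hp, subset_rfl⟩

theorem isInteriorComplex_maximalTopeComplex : IsInteriorComplex 5 maximalTopeComplex := by
  refine ⟨⟨Finset.univ.image (graphVertex (target (0, 0))),
    image_graphVertex_mem_faces (by decide), fun t ht hst => ?_⟩, fun s hs => ?_⟩
  · obtain ⟨-, q, -, htq⟩ := mem_maximalTopeFaces.1 ht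
    refine Finset.eq_of_subset_of_card_le hst ((Finset.card_le_card htq).trans ?_)
    rw [card_image_graphVertex, card_image_graphVertex]
  · obtain ⟨-, p, hp, hsp⟩ := mem_maximalTopeFaces.1 hs.1
    obtain rfl := hs.2 (image_graphVertex_mem_faces hp) hsp
    exact ⟨card_image_graphVertex p, _, (vertexSet_graphOn p).symm, isInteriorPolytope_graphOn p⟩

theorem pair_mem_faces {a b : Fin 4} (h : (a, b) ∈ pairs) :
    {prodVertex (4, a), prodVertex (5, b)} ∈ maximalTopeComplex.faces := by
  refine maximalTopeComplex.down_closed (image_graphVertex_mem_faces h) ?_ (by simp)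
  simp only [Finset.insert_subset_iff, Finset.singleton_subset_iff]
  exact ⟨Finset.mem_image.2 ⟨4, Finset.mem_univ _, rfl⟩,
    Finset.mem_image.2 ⟨5, Finset.mem_univ _, rfl⟩⟩

/-! ### Non-polyhedrality and conclusion -/

theorem exists_matching : ∀ p ∈ ({(0, 1), (1, 2), (2, 0)} : Finset (Fin 4 × Fin 4)), ∃ σ,
    σ.card = ∑ r, matchingField.type r ∧ (4, p.1) ∈ matchingField.tope σ ∧
      (5, p.2) ∈ matchingField.tope σ := by
  decide +kernel

theorem not_isPolyhedral_matchingField : ¬ matchingField.IsPolyhedral := by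
  rintro ⟨K, hK, hmatch⟩
  have hpair : ∀ a b : Fin 4, (a, b) ∈ ({(0, 1), (1, 2), (2, 0)} : Finset (Fin 4 × Fin 4)) →
      {prodVertex (4, a), prodVertex (5, b)} ∈ K.faces := by
    intro a b hab
    obtain ⟨σ, hσ, h4, h5⟩ := exists_matching _ hab
    refine K.down_closed ((hmatch σ (hσ.trans sum_type_matchingField) _
      (matchingField.isTope σ hσ)).2 rfl) ?_ (by simp)
    simp only [Finset.insert_subset_iff, Finset.singleton_subset_iff]
    exact ⟨Finset.mem_image_of_mem _ h4, Finset.mem_image_of_mem _ h5⟩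
  exact not_isTriangulation_of_cyclic (hpair 0 1 (by decide)) (hpair 1 2 (by decide))
    (hpair 2 0 (by decide)) hK

end TropicalExample

theorem mainTheorem12 :
    ∃ M : TopeField 6 4, M.IsMatchingField ∧
      (∀ j : Fin 6, M.covector (Finset.univ.erase j) = exampleCovector j) ∧
      M.IsLinkage ∧ ¬ M.IsPolyhedral ∧
      ∃ K : Geometry.SimplicialComplex ℝ ((Fin 6 → ℝ) × (Fin 4 → ℝ)),
        K.faces = M.maximalTopeFaces ∧
        IsInteriorComplex 5 K ∧
        ¬ ∃ K' : Geometry.SimplicialComplex ℝ ((Fin 6 → ℝ) × (Fin 4 → ℝ)),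
          IsTriangulation K' ∧ K ≤ K' := by
  refine ⟨TropicalExample.matchingField, rfl, TropicalExample.covector_matchingField,
    TropicalExample.isLinkage_matchingField, TropicalExample.not_isPolyhedral_matchingField,
    TropicalExample.maximalTopeComplex, rfl,
    TropicalExample.isInteriorComplex_maximalTopeComplex, ?_⟩
  rintro ⟨K', hK', hle⟩
  exact TropicalExample.not_isTriangulation_of_cyclic
    (hle (TropicalExample.pair_mem_faces (by decide)))
    (hle (TropicalExample.pair_mem_faces (by decide)))
    (hle (TropicalExample.pair_mem_faces (by decide))) hK'
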